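/- **Model.** The deterministic Congested Clique on $n$ nodes with identifiers $1,\dots,n$: in each synchronous round every node sends one message of $O(\log n)$ bits to every other node; local computation is unrestricted, and $n,k,h,i$ are known to all nodes. Graphs are simple directed graphs on the $n$ nodes whose edge weights are positive integers bounded by a polynomial in $n$, and each node initially knows exactly its incident (incoming and outgoing) edges, with their weights, of each input graph. **Notions.** The hops of a path are its edges, its length is the sum of its edge weights. $d_G(u,v)$ is the minimum length of a path from $u$ to $v$ in $G$, and the $q$-hop distance is the minimum length of such a path with at most $q$ hops ($\infty$ if there is none). $N_k(v)$ (resp. $N_k^q(v)$) is the set of the $k$ nodes $u$ with the smallest distance (resp. $q$-hop distance) from $v$ to $u$, ties broken by identifiers (all nodes if $k\ge n$; note $v\in N_k(v)$ for $k \geq 1$). A graph $H$ on the nodes of $G$ is a *$k$-nearest $\beta$-hopset* for $G$ if $d_G(u,v)=d_{G\cup H}(u,v)$ for all $u,v$, and for all $u$ and all $v\in N_k(u)$ with $d_G(u,v)<\infty$ there is a path from $u$ to $v$ in $G\cup H$ with at most $\beta$ hops and length exactly $d_G(u,v)$. **Lemma 3.3 (Computing $k$-nearest nodes).** Let $k,h,i$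 be positive integers with $k\in O(n^{1/h})$. 1. Given a weighted directed graph $G$ and a $k$-nearest $h^i$-hopset $H$ for $G$, there is a deterministic Congested Clique algorithm in which, after $O(i)$ rounds, each node $v$ knows $N_k(v)$ and the exact distances $d_G(v,u)$ to all $u\in N_k(v)$. 2. Given a weighted directed graph $G$ (and no hopset), there is a deterministic Congested Clique algorithm in which, after $O(i)$ rounds, each node $v$ knows $N_k^{h^i}(v)$ and the $h^i$-hop distances from $v$ to all $u\in N_k^{h^i}(v)$. Precisely: for every $c$ there is $b$ such that for every $C$ there is $D$ such that for all $n$ and all positive integers $k,h,i$ with $k\le C n^{1/h}$ there are such algorithms, using messages of $b(\lfloor\log_2 n\rfloor+1)$ bits and at most $D\cdot i$ rounds, that are correct for all inputs with edge weights at most $n^c$. -/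

import Mathlib

/-- A simple weighted directed graph on the node set `{0, …, n-1}` (the node is its own identifier)
with positive integer weights; `weight u v = ⊤` means that there is no edge from `u` to `v`. -/
structure WDigraph (n : ℕ) where
  weight : Fin n → Fin n → ℕ∞
  loopless : ∀ v, weight v v = ⊤
  pos : ∀ u v, 0 < weight u v

namespace WDigraph

variable {n : ℕ}

/-- Every edge of `G` has weight at most `W`. -/
def WeightsLE (G : WDigraph n) (W : ℕ) : Prop :=
  ∀ u v, G.weight u v ≠ ⊤ → G.weight u v ≤ (W : ℕ∞)

/-- The union of two graphs on the same node set; of two parallel edges the lighter one is kept. -/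
noncomputable def union (G H : WDigraph n) : WDigraph n where
  weight u v := min (G.weight u v) (H.weight u v)
  loopless v := by simp [G.loopless, H.loopless]
  pos u v := lt_min (G.pos u v) (H.pos u v)

/-- `G.HasPath u v t l`: there is a directed path from `u` to `v` in `G` with exactly `t` hops
and length `l`. -/
inductive HasPath (G : WDigraph n) : Fin n → Fin n → ℕ → ℕ → Prop
  | nil (u : Fin n) : HasPath G u u 0 0
  | cons {u x v : Fin n} {w t l : ℕ} :
      G.weight u x = (w : ℕ∞) → HasPath G x v t l → HasPath G u v (t + 1) (w + l)

/-- The distance from `u` to `v`: the minimum length of a path, `⊤` if there is none. -/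
noncomputable def dist (G : WDigraph n) (u v : Fin n) : ℕ∞ :=
  sInf {x : ℕ∞ | ∃ t l : ℕ, G.HasPath u v t l ∧ x = (l : ℕ∞)}

/-- The `q`-hop distance from `u` to `v`: the minimum length of a path with at most `q` hops,
`⊤` if there is none. -/
noncomputable def hopDist (G : WDigraph n) (q : ℕ) (u v : Fin n) : ℕ∞ :=
  sInf {x : ℕ∞ | ∃ t l : ℕ, t ≤ q ∧ G.HasPath u v t l ∧ x = (l : ℕ∞)}

end WDigraph

/-- The `k` nodes with the smallest values of `f`, ties broken by identifiers
(all nodes if `k ≥ n`): those nodes that fewer than `k` nodes precede. -/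
noncomputable def kSmallest {n : ℕ} (k : ℕ) (f : Fin n → ℕ∞) : Finset (Fin n) :=
  open Classical in
  Finset.univ.filter fun v =>
    (Finset.univ.filter fun u => f u < f v ∨ (f u = f v ∧ u < v)).card < k

namespace WDigraph

variable {n : ℕ}

/-- `N_k(v)`: the `k` nearest nodes, with respect to the distances from `v`. -/
noncomputable def kNearest (G : WDigraph n) (k : ℕ) (v : Fin n) : Finset (Fin n) :=
  kSmallest k (G.dist v)

/-- `N_k^q(v)`: the `k` nearest nodes, with respect to the `q`-hop distances from `v`. -/
noncomputable def kNearestHop (G : WDigraph n) (k q : ℕ) (v : Fin n) : Finset (Fin n) :=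
  kSmallest k (G.hopDist q v)

/-- `H` is a `k`-nearest `β`-hopset for `G`. The path is asked for only if `v` can be reached
from `u` at all (`N_k(u)` contains unreachable nodes if fewer than `k` nodes are reachable). -/
structure IsKNearestHopset (k β : ℕ) (G H : WDigraph n) : Prop where
  dist_eq : ∀ u v, G.dist u v = (G.union H).dist u v
  path : ∀ u, ∀ v ∈ G.kNearest k u, ∀ d : ℕ, G.dist u v = (d : ℕ∞) →
    ∃ t ≤ β, (G.union H).HasPath u v t d

/-- The set of the pairs `(u, d(v, u))` with `u ∈ N_k(v)`. -/
noncomputable def nearestDistances (G : WDigraph n) (k : ℕ) (v : Fin n) :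
    Finset (Fin n × ℕ∞) :=
  open Classical in (G.kNearest k v).image fun u => (u, G.dist v u)

/-- The set of the pairs `(u, d^q(v, u))` with `u ∈ N_k^q(v)`, `d^q` the `q`-hop distance. -/
noncomputable def nearestHopDistances (G : WDigraph n) (k q : ℕ) (v : Fin n) :
    Finset (Fin n × ℕ∞) :=
  open Classical in (G.kNearestHop k q v).image fun u => (u, G.hopDist q v u)

end WDigraph

/-- What a node knows of a graph initially: its outgoing and incoming edges with their weights. -/
structure IncidentEdges (n : ℕ) where
  outgoing : Fin n → ℕ∞
  incoming : Fin n → ℕ∞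

/-- The edges of `G` incident to `v`. -/
def WDigraph.incident {n : ℕ} (G : WDigraph n) (v : Fin n) : IncidentEdges n where
  outgoing u := G.weight v u
  incoming u := G.weight u v

/-- A deterministic algorithm on a clique of `n` nodes with messages of `B` bits. In each
synchronous round every node sends one message to each node, as a function of its own state,
and updates its state from the messages it receives. Local computation is unrestricted. -/
structure CliqueAlgorithm (n B : ℕ) (Input Output : Type) where
  State : Type
  init : Fin n → Input → State
  send : Fin n → State → (receiver : Fin n) → (Fin B → Bool)
  receive : Fin n → State → ((sender : Fin n) → (Fin B → Bool)) → State
  output : Fin n → State → Output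

namespace CliqueAlgorithm

variable {n B : ℕ} {Input Output : Type}

/-- The state of every node after `T` rounds. -/
def stateAfter (A : CliqueAlgorithm n B Input Output) (inp : Fin n → Input) :
    ℕ → Fin n → A.State
  | 0, v => A.init v (inp v)
  | T + 1, v => A.receive v (A.stateAfter inp T v) fun u => A.send u (A.stateAfter inp T u) v

/-- The output of node `v` after `T` rounds. -/
def outputAfter (A : CliqueAlgorithm n B Input Output) (inp : Fin n → Input) (T : ℕ)
    (v : Fin n) : Output :=
  A.output v (A.stateAfter inp T v)

end CliqueAlgorithm

/-- The message size `b · (⌊log₂ n⌋ + 1)`, in bits. -/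
def messageBits (b n : ℕ) : ℕ := b * (Nat.log 2 n + 1)

/- The `q`-hop distances are the `q`-th power, over the min-plus semiring, of the matrix of the
one-hop distances. Every node on a shortest path from `v` to one of the `k` nearest nodes of `v`
is among the `k` nearest nodes of its predecessor, so the `k` smallest entries of each row of the
`h`-th power of a matrix depend only on the `k` smallest entries of its rows. These are computed
in `O(1)` rounds: every set of at most `h` rows is contained in one of `n` sets `U w`, obtained by
cutting the nodes into `h * m` blocks with `m` about `n ^ (1 / h) / 3` and taking all unions of
`h` blocks. Node `w` collects the rows of the nodes in `U w` and returns its candidates for the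
shortest paths that leave only nodes of `U w`. No node sends or receives more than `O(n)` entries,
and such a load is routed in `O(1)` rounds through relays chosen by an edge colouring. Taking the
`h`-th power `i` times yields the `h ^ i`-hop distances, and a `k`-nearest `h ^ i`-hopset makes
those to the `k` nearest nodes exact. -/

open Finset Tropical

namespace CliqueAlgorithm

variable {n B : ℕ} {S₁ S₂ S₃ : Type}

/-- Handing over from `A₁` to `A₂`: the state of the composite algorithm that has `t` rounds of `A₁`
still to run from the state `s`. -/
def handover (A₁ : CliqueAlgorithm n B S₁ S₂) (A₂ : CliqueAlgorithm n B S₂ S₃) (v : Fin n)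
    (s : A₁.State) : ℕ → ℕ × A₁.State ⊕ A₂.State
  | 0 => .inr (A₂.init v (A₁.output v s))
  | t + 1 => .inl (t, s)

/-- Sequential composition: `T` rounds of `A₁`, whose outputs are the inputs of `A₂`. -/
def andThen (A₁ : CliqueAlgorithm n B S₁ S₂) (T : ℕ) (A₂ : CliqueAlgorithm n B S₂ S₃) :
    CliqueAlgorithm n B S₁ S₃ where
  State := ℕ × A₁.State ⊕ A₂.State
  init v x := handover A₁ A₂ v (A₁.init v x) T
  send v := Sum.elim (fun s => A₁.send v s.2) (A₂.send v)
  receive v s msg :=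
    s.elim (fun s => handover A₁ A₂ v (A₁.receive v s.2 msg) s.1) fun s => .inr (A₂.receive v s msg)
  output v := Sum.elim (fun s => A₂.output v (A₂.init v (A₁.output v s.2))) (A₂.output v)

variable (A₁ : CliqueAlgorithm n B S₁ S₂) (A₂ : CliqueAlgorithm n B S₂ S₃) (inp : Fin n → S₁)

theorem stateAfter_andThen_of_add_eq {T t r : ℕ} (h : t + r = T) (v : Fin n) :
    (A₁.andThen T A₂).stateAfter inp t v = handover A₁ A₂ v (A₁.stateAfter inp t v) r := by
  induction t generalizing r v with
  | zero => rw [← h, zero_add]; rfl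
  | succ t ih => simp only [stateAfter, ih (r := r + 1) (by omega)]; rfl

theorem stateAfter_andThen_add (T t : ℕ) (v : Fin n) :
    (A₁.andThen T A₂).stateAfter inp (T + t) v =
      .inr (A₂.stateAfter (A₁.outputAfter inp T) t v) := by
  induction t generalizing v with
  | zero => exact stateAfter_andThen_of_add_eq A₁ A₂ inp (add_zero T) v
  | succ t ih => rw [← Nat.add_assoc, stateAfter]; simp only [ih]; rfl

theorem outputAfter_andThen (T t : ℕ) (v : Fin n) :
    (A₁.andThen T A₂).outputAfter inp (T + t) v =
      A₂.outputAfter (A₁.outputAfter inp T) t v := by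
  rw [outputAfter, stateAfter_andThen_add]; rfl

end CliqueAlgorithm

/-- With messages of `B` bits, nodes `v` that know `σ i v` can compute `τ i v` in `T` rounds, by one
algorithm for all the instances `i`. -/
def CliqueComputable {n : ℕ} {ι : Type*} {S S' : Type} (B T : ℕ) (σ : ι → Fin n → S)
    (τ : ι → Fin n → S') : Prop :=
  ∃ A : CliqueAlgorithm n B S S', ∀ i v, A.outputAfter (σ i) T v = τ i v

namespace CliqueComputable

variable {n B T T' : ℕ} {ι : Type*} {S S' S'' : Type}
  {σ : ι → Fin n → S} {τ : ι → Fin n → S'} {ρ : ι → Fin n → S''}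

theorem of_local (f : Fin n → S → S') (hf : ∀ i v, f v (σ i v) = τ i v) :
    CliqueComputable B 0 σ τ :=
  ⟨⟨S, fun _ s => s, fun _ _ _ _ => false, fun _ s _ => s, f⟩, hf⟩

theorem trans (h : CliqueComputable B T σ τ) (h' : CliqueComputable B T' τ ρ) :
    CliqueComputable B (T + T') σ ρ := by
  obtain ⟨A, hA⟩ := h
  obtain ⟨A', hA'⟩ := h'
  refine ⟨A.andThen T A', fun i v => ?_⟩
  rw [A.outputAfter_andThen, funext (hA i), hA']

theorem map (h : CliqueComputable B T σ τ) (f : Fin n → S' → S'')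
    (hf : ∀ i v, f v (τ i v) = ρ i v) : CliqueComputable B T σ ρ :=
  h.trans (of_local f hf)

theorem exchange_once (σ : ι → Fin n → S) (send : Fin n → S → Fin n → Fin B → Bool) :
    CliqueComputable B 1 σ fun i v => (σ i v, fun u => send u (σ i u) v) :=
  ⟨{ State := S × (Fin n → Fin B → Bool)
     init _ s := (s, fun _ _ => false)
     send v s := send v s.1
     receive _ s msg := (s.1, msg)
     output _ s := s }, fun _ _ => rfl⟩

theorem exchange (R : ℕ) (σ : ι → Fin n → S) (send : Fin n → S → Fin n → Fin R → Fin B → Bool) :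
    CliqueComputable B R σ fun i v => (σ i v, fun u => send u (σ i u) v) := by
  induction R with
  | zero => exact of_local (fun _ s => (s, fun _ => Fin.elim0)) fun i v =>
      Prod.ext rfl (funext fun u => Subsingleton.elim _ _)
  | succ R ih =>
    refine ((ih fun u s v => Fin.init (send u s v)).trans
      (exchange_once _ fun u s v => send u s.1 v (Fin.last R))).map
      (fun _ s => (s.1.1, fun u => Fin.snoc (s.1.2 u) (s.2 u))) fun i v => ?_
    simp only [Fin.snoc_init_self]

end CliqueComputable

theorem nonempty_coloring_of_degree_lt {V κ : Type*} [Fintype V] [Fintype κ] (G : SimpleGraph V)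
    [DecidableRel G.Adj] (hG : ∀ v, G.degree v < Fintype.card κ) : Nonempty (G.Coloring κ) := by
  classical
  suffices extend : ∀ s : Finset V, ∃ col : V → κ, ∀ u ∈ s, ∀ v ∈ s, G.Adj u v → col u ≠ col v by
    obtain ⟨col, hcol⟩ := extend univ
    exact ⟨SimpleGraph.Coloring.mk col fun h => hcol _ (mem_univ _) _ (mem_univ _) h⟩
  intro s
  induction s using Finset.induction_on with
  | empty =>
    exact ⟨fun v => (Fintype.card_pos_iff.1 ((Nat.zero_le _).trans_lt (hG v))).some, by simp⟩
  | insert a s ha ih =>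
    obtain ⟨col, hcol⟩ := ih
    obtain ⟨q, hq⟩ : ∃ q, q ∉ (G.neighborFinset a).image col := by
      by_contra! hall
      exact ((hG a).trans_le' card_image_le).ne (congrArg card (eq_univ_of_forall hall))
    have hqa : ∀ v, G.Adj a v → q ≠ col v := fun v hv h =>
      hq (mem_image.2 ⟨v, (G.mem_neighborFinset a v).2 hv, h.symm⟩)
    refine ⟨Function.update col a q, fun u hu v hv huv => ?_⟩
    rcases eq_or_ne u a with rfl | hua
    · rw [Function.update_self, Function.update_of_ne huv.ne']
      exact hqa v huv
    rcases eq_or_ne v a with rfl | hva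
    · rw [Function.update_self, Function.update_of_ne hua]
      exact (hqa u huv.symm).symm
    rw [Function.update_of_ne hua, Function.update_of_ne hva]
    exact hcol u (mem_of_mem_insert_of_ne hu hua) v (mem_of_mem_insert_of_ne hv hva) huv

theorem exists_edge_coloring {E X Y κ : Type*} [Fintype E] [Fintype κ] [DecidableEq X]
    [DecidableEq Y] {src : E → X} {dst : E → Y} {L : ℕ} (hsrc : ∀ x, #{e | src e = x} ≤ L)
    (hdst : ∀ y, #{e | dst e = y} ≤ L) (hκ : 2 * L ≤ Fintype.card κ) :
    ∃ col : E → κ, (Function.Injective fun e => (src e, col e)) ∧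
      Function.Injective fun e => (dst e, col e) := by
  classical
  let conflict : SimpleGraph E := .fromRel fun e e' => src e = src e' ∨ dst e = dst e'
  have hdeg : ∀ e, conflict.degree e < Fintype.card κ := by
    intro e
    have hsub : conflict.neighborFinset e ⊆ ({e' | src e' = src e} : Finset E).erase e ∪
        ({e' | dst e' = dst e} : Finset E).erase e := by
      intro e'
      simp only [conflict, SimpleGraph.mem_neighborFinset, SimpleGraph.fromRel_adj, mem_union,
        mem_erase, mem_filter_univ]
      grind
    have hs := card_erase_lt_of_mem (s := {e' | src e' = src e}) (a := e) (by simp)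
    have hd := card_erase_lt_of_mem (s := {e' | dst e' = dst e}) (a := e) (by simp)
    have := (card_le_card hsub).trans (card_union_le _ _)
    have := hsrc (src e)
    have := hdst (dst e)
    rw [← conflict.card_neighborFinset_eq_degree]
    omega
  obtain ⟨col⟩ := nonempty_coloring_of_degree_lt conflict hdeg
  have hcol : ∀ e e', src e = src e' ∨ dst e = dst e' → col e = col e' → e = e' :=
    fun e e' h hc => by_contra fun hne => col.valid ⟨hne, .inl h⟩ hc
  exact ⟨col, fun e e' h => hcol e e' (.inl (Prod.mk.inj h).1) (Prod.mk.inj h).2,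
    fun e e' h => hcol e e' (.inr (Prod.mk.inj h).1) (Prod.mk.inj h).2⟩

/-- What node `v` holds once every `msg e` has been delivered to node `dst e`. -/
def inbox {n : ℕ} {E α : Type*} (dst : E → Fin n) (msg : E → α) (v : Fin n) (e : E) : Option α :=
  if dst e = v then some (msg e) else none

theorem inbox_self {n : ℕ} {E α : Type*} (dst : E → Fin n) (msg : E → α) (e : E) :
    inbox dst msg (dst e) e = some (msg e) :=
  if_pos rfl

namespace CliqueComputable

variable {n B : ℕ} {ι : Type*} {S E : Type} {src dst : E → Fin n}

theorem deliver {R : ℕ} (time : E → Fin R)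
    (h : Function.Injective fun e => (src e, dst e, time e)) (σ : ι → Fin n → S)
    (word : E → S → Fin B → Bool) :
    CliqueComputable B R σ fun i => inbox dst fun e => word e (σ i (src e)) := by
  let send (u : Fin n) (s : S) (v : Fin n) (t : Fin R) : Fin B → Bool :=
    Function.extend (fun e => (src e, dst e, time e)) (word · s) (fun _ _ => false) (u, v, t)
  have hsend : ∀ e s, send (src e) s (dst e) (time e) = word e s := fun e s =>
    h.extend_apply (word · s) _ e
  refine (exchange R σ send).map
    (fun v s e => if dst e = v then some (s.2 (src e) (time e)) else none) fun i v => ?_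
  ext1 e
  unfold inbox
  split_ifs with hv
  · subst hv
    exact congrArg some (hsend e _)
  · rfl

/- A colour of a message is a pair of a round and a relay: messages of the same colour have distinct
sources and distinct destinations. -/
theorem route [Fintype E] {M : ℕ} (hsrc : ∀ v, #{e | src e = v} ≤ M * n)
    (hdst : ∀ v, #{e | dst e = v} ≤ M * n) (σ : ι → Fin n → S) (word : E → S → Fin B → Bool) :
    CliqueComputable B (4 * M) σ fun i => inbox dst fun e => word e (σ i (src e)) := by
  obtain ⟨col, hcs, hcd⟩ := exists_edge_coloring (κ := Fin (2 * M) × Fin n) hsrc hdst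
    (by simp [mul_assoc])
  let time (e : E) := (col e).1
  let relay (e : E) := (col e).2
  have toRelay := deliver (B := B) (src := src) (dst := relay) time
    (fun e e' h => hcs (by simp_all [time, relay, Prod.ext_iff])) σ word
  have fromRelay := deliver (B := B) (src := relay) (dst := dst) time
    (fun e e' h => hcd (by simp_all [time, relay, Prod.ext_iff]))
    (fun i => inbox relay fun e => word e (σ i (src e))) fun e box => (box e).getD fun _ => false
  simp only [inbox_self, Option.getD_some] at fromRelay
  rw [show 4 * M = 2 * M + 2 * M by ring]
  exact toRelay.trans fromRelay

end CliqueComputable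

/-- The finite values of `f` are at most `N`. -/
def FiniteValuesLE {V : Type*} (N : ℕ) (f : V → ℕ∞) : Prop :=
  ∀ u, f u ≠ ⊤ → f u ≤ N

theorem FiniteValuesLE.mono {V : Type*} {N N' : ℕ} {f : V → ℕ∞} (h : FiniteValuesLE N f)
    (hN : N ≤ N') : FiniteValuesLE N' f :=
  fun u hu => (h u hu).trans (Nat.cast_le.2 hN)

theorem FiniteValuesLE.le_of_forall_eq {V : Type*} {N : ℕ} {f g : V → ℕ∞} (hf : FiniteValuesLE N f)
    (h : ∀ u, ∀ a : Fin (N + 1), f u = (a : ℕ) → g u = (a : ℕ)) : g ≤ f := by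
  intro u
  by_cases hu : f u = ⊤
  · exact hu ▸ le_top
  obtain ⟨a, ha⟩ := ENat.ne_top_iff_exists.1 hu
  have haN : a ≤ N := Nat.cast_le.1 (ha.trans_le (hf u hu))
  rw [h u ⟨a, Nat.lt_succ_of_le haN⟩ ha.symm, ← ha]

/-- `f` has at most `k` finite values, and they are at most `N`. -/
structure IsSparse {V : Type*} [Fintype V] (k N : ℕ) (f : V → ℕ∞) : Prop where
  card_le : #{u | f u ≠ ⊤} ≤ k
  finiteValuesLE : FiniteValuesLE N f

theorem exists_enumeration {α : Type*} (s : Finset α) {k : ℕ} (hs : #s ≤ k) :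
    ∃ l : Fin k → Option α, (∀ a, (∃ j, l j = some a) ↔ a ∈ s) ∧
      ∀ a i j, l i = some a → l j = some a → i = j := by
  refine ⟨fun j => s.toList[(j : ℕ)]?, fun a => ⟨?_, fun ha => ?_⟩, fun a i j hi hj => ?_⟩
  · rintro ⟨j, hj⟩
    exact mem_toList.1 (List.mem_of_getElem? hj)
  · obtain ⟨j, hj, rfl⟩ := List.mem_iff_getElem.1 (mem_toList.2 ha)
    exact ⟨⟨j, hj.trans_le ((length_toList s).trans_le hs)⟩, List.getElem?_eq_getElem hj⟩
  · obtain ⟨hi_lt, -⟩ := List.getElem?_eq_some_iff.1 hi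
    exact Fin.ext ((List.getElem?_inj hi_lt s.nodup_toList).1 (hi.trans hj.symm))

theorem exists_row_code {V : Type*} [Fintype V] {N B : ℕ} (k : ℕ)
    (hB : Fintype.card (Option (V × Fin (N + 1))) ≤ 2 ^ B) :
    ∃ (enc : (V → ℕ∞) → Fin k → Fin B → Bool) (dec : (Fin k → Fin B → Bool) → V → ℕ∞),
      ∀ f, IsSparse k N f → dec (enc f) = f := by
  classical
  have entries (f : V → ℕ∞) (hf : IsSparse k N f) :
      ∃ l : Fin k → Option (V × Fin (N + 1)), ∀ p, (∃ j, l j = some p) ↔ f p.1 = (p.2 : ℕ) := by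
    have hcard : #{p : V × Fin (N + 1) | f p.1 = (p.2 : ℕ)} ≤ k := by
      refine (card_le_card_of_injOn Prod.fst (fun p hp => ?_) fun p hp q hq hpq => ?_).trans
        hf.card_le
      · simp_all
      · simp only [coe_filter_univ, Set.mem_ofPred_eq] at hp hq
        exact Prod.ext hpq (Fin.ext (Nat.cast_injective (R := ℕ∞) (hp ▸ hq ▸ hpq ▸ rfl)))
    obtain ⟨l, hl, -⟩ := exists_enumeration _ hcard
    exact ⟨l, by simpa using hl⟩
  choose! l hl using entries
  obtain ⟨word⟩ : Nonempty (Option (V × Fin (N + 1)) ↪ (Fin B → Bool)) :=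
    Function.Embedding.nonempty_of_card_le (by simpa using hB)
  have hinj : Set.InjOn (fun f j => word (l f j)) {f | IsSparse k N f} := fun f hf g hg h => by
    have hiff : ∀ u, ∀ a : Fin (N + 1), f u = (a : ℕ) ↔ g u = (a : ℕ) := fun u a => by
      rw [← hl f hf (u, a), ← hl g hg (u, a), word.injective.comp_left h]
    exact le_antisymm (hg.finiteValuesLE.le_of_forall_eq fun u a => (hiff u a).2)
      (hf.finiteValuesLE.le_of_forall_eq fun u a => (hiff u a).1)
  exact ⟨_, _, hinj.leftInvOn_invFunOn⟩

section KSmallest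

variable {n k : ℕ} {f g : Fin n → ℕ∞} {u v : Fin n}

/-- The pair `(f v, v)`, by which `kSmallest` orders the nodes, in the lexicographic order. -/
def nodeKey (f : Fin n → ℕ∞) (v : Fin n) : ℕ∞ ×ₗ Fin n :=
  toLex (f v, v)

theorem nodeKey_injective (f : Fin n → ℕ∞) : Function.Injective (nodeKey f) :=
  fun _ _ h => (Prod.mk.inj (toLex.injective h)).2

theorem nodeKey_mono (h : f v ≤ g v) : nodeKey f v ≤ nodeKey g v :=
  Prod.Lex.toLex_mono ⟨h, le_rfl⟩

theorem nodeKey_congr (h : f v = g v) : nodeKey f v = nodeKey g v := by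
  rw [nodeKey, nodeKey, h]

/-- The position of `v` in the order of the nodes by their keys. -/
def nodeRank (f : Fin n → ℕ∞) (v : Fin n) : ℕ :=
  #{u | nodeKey f u < nodeKey f v}

theorem mem_kSmallest : v ∈ kSmallest k f ↔ nodeRank f v < k := by
  simp [kSmallest, nodeRank, nodeKey, Prod.Lex.toLex_lt_toLex]

theorem nodeRank_lt (f : Fin n → ℕ∞) (v : Fin n) : nodeRank f v < n := by
  have hss : ({u | nodeKey f u < nodeKey f v} : Finset (Fin n)) ⊂ univ :=
    filter_ssubset.2 ⟨v, mem_univ v, lt_irrefl _⟩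
  simpa [nodeRank] using card_lt_card hss

theorem nodeRank_lt_nodeRank (h : nodeKey f u < nodeKey f v) : nodeRank f u < nodeRank f v :=
  card_lt_card <| (ssubset_iff_of_subset (monotone_filter_right univ fun _ _ hw => hw.trans h)).2
    ⟨u, by simpa using h, by simp⟩

theorem nodeRank_injective (f : Fin n → ℕ∞) : Function.Injective (nodeRank f) := by
  intro u v h
  rcases lt_trichotomy (nodeKey f u) (nodeKey f v) with huv | huv | huv
  · exact absurd h (nodeRank_lt_nodeRank huv).ne
  · exact nodeKey_injective f huv
  · exact absurd h (nodeRank_lt_nodeRank huv).ne'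

theorem card_kSmallest (k : ℕ) (f : Fin n → ℕ∞) : #(kSmallest k f) = min n k := by
  let rank (v : Fin n) : Fin n := ⟨nodeRank f v, nodeRank_lt f v⟩
  have hrank : Function.Injective rank := fun u v h => nodeRank_injective f (Fin.mk.inj h)
  rw [← Fin.card_filter_val_lt]
  exact card_bijective rank (Finite.injective_iff_bijective.1 hrank) fun v => by
    simp [mem_kSmallest, rank]

theorem mem_kSmallest_of_forall_nodeKey_lt (hv : v ∈ kSmallest k g)
    (h : ∀ y, nodeKey f y < nodeKey f u → nodeKey g y < nodeKey g v) : u ∈ kSmallest k f :=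
  mem_kSmallest.2 <| (card_le_card fun y hy => by simp_all).trans_lt (mem_kSmallest.1 hv)

theorem mem_kSmallest_of_le (hle : f ≤ g) (hv : v ∈ kSmallest k f) (h : g v = f v) :
    v ∈ kSmallest k g :=
  mem_kSmallest_of_forall_nodeKey_lt hv fun y hy =>
    (nodeKey_mono (hle y)).trans_lt (hy.trans_eq (nodeKey_congr h))

theorem kSmallest_congr (hle : f ≤ g) (h : ∀ u ∈ kSmallest k f, g u = f u) :
    kSmallest k g = kSmallest k f :=
  (eq_of_subset_of_card_le (fun v hv => mem_kSmallest_of_le hle hv (h v hv))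
    (by rw [card_kSmallest, card_kSmallest])).symm

/-- The row `f` with all but its `k` smallest entries replaced by `⊤`. -/
noncomputable def keepSmallest (k : ℕ) (f : Fin n → ℕ∞) (u : Fin n) : ℕ∞ :=
  if u ∈ kSmallest k f then f u else ⊤

theorem keepSmallest_of_mem (h : u ∈ kSmallest k f) : keepSmallest k f u = f u :=
  if_pos h

theorem keepSmallest_of_notMem (h : u ∉ kSmallest k f) : keepSmallest k f u = ⊤ :=
  if_neg h

theorem le_keepSmallest (k : ℕ) (f : Fin n → ℕ∞) : f ≤ keepSmallest k f := by
  intro u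
  by_cases h : u ∈ kSmallest k f
  · exact (keepSmallest_of_mem h).ge
  · exact (keepSmallest_of_notMem h).symm ▸ le_top

theorem keepSmallest_congr (hle : f ≤ g) (h : ∀ u ∈ kSmallest k f, g u = f u) :
    keepSmallest k g = keepSmallest k f := by
  ext1 u
  unfold keepSmallest
  rw [kSmallest_congr hle h]
  exact if_ctx_congr Iff.rfl (h u) fun _ => rfl

theorem kSmallest_keepSmallest (k : ℕ) (f : Fin n → ℕ∞) :
    kSmallest k (keepSmallest k f) = kSmallest k f :=
  kSmallest_congr (le_keepSmallest k f) fun _ => keepSmallest_of_mem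

protected theorem FiniteValuesLE.keepSmallest {N : ℕ} (hf : FiniteValuesLE N f) (k : ℕ) :
    FiniteValuesLE N (keepSmallest k f) := by
  intro u hu
  have hmem : u ∈ kSmallest k f := not_imp_comm.1 keepSmallest_of_notMem hu
  rw [keepSmallest_of_mem hmem] at hu ⊢
  exact hf u hu

theorem FiniteValuesLE.isSparse_keepSmallest {N : ℕ} (hf : FiniteValuesLE N f) (k : ℕ) :
    IsSparse k N (keepSmallest k f) where
  card_le := by
    refine (card_le_card fun u hu => ?_).trans ((card_kSmallest k f).trans_le (min_le_right n k))
    exact not_imp_comm.1 keepSmallest_of_notMem (mem_filter_univ u |>.1 hu)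
  finiteValuesLE := hf.keepSmallest k

end KSmallest

section MinPlus

variable {V : Type*} [DecidableEq V] {A A' : V → V → ℕ∞} {N : ℕ}

/-- Exactly the diagonal entries of `A` vanish. -/
def ZeroIffEq (A : V → V → ℕ∞) : Prop :=
  ∀ u v, A u v = 0 ↔ u = v

/-- The matrix `A` with the rows outside of `s` replaced by those of the identity matrix: of the
edges of a graph, only those leaving `s` are kept. -/
def restrictRows (A : V → V → ℕ∞) (s : Finset V) (u v : V) : ℕ∞ :=
  if u ∈ s then A u v else if u = v then 0 else ⊤

theorem restrictRows_of_mem {s : Finset V} {u : V} (h : u ∈ s) : restrictRows A s u = A u :=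
  funext fun _ => if_pos h

protected theorem FiniteValuesLE.restrictRows (hA : ∀ u, FiniteValuesLE N (A u)) (s : Finset V)
    (u : V) : FiniteValuesLE N (restrictRows A s u) := by
  intro v hv
  by_cases hu : u ∈ s
  · rw [restrictRows_of_mem hu] at hv ⊢
    exact hA u v hv
  · by_cases huv : u = v <;> simp_all [restrictRows]

namespace ZeroIffEq

protected theorem restrictRows (hA : ZeroIffEq A) (s : Finset V) :
    ZeroIffEq (restrictRows A s) := by
  intro u v
  by_cases hu : u ∈ s
  · rw [restrictRows_of_mem hu, hA]
  · simp [restrictRows, hu]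

theorem le_restrictRows (hA : ZeroIffEq A) (s : Finset V) : A ≤ restrictRows A s := by
  intro u v
  unfold restrictRows
  split_ifs with hu huv
  · exact le_rfl
  · exact ((hA u v).2 huv).le
  · exact le_top

end ZeroIffEq

variable [Fintype V]

/-- The `m`-th power of the matrix `A` over the min-plus semiring. -/
def minPlusPow (A : V → V → ℕ∞) (m : ℕ) (u v : V) : ℕ∞ :=
  untrop ((Matrix.of (fun u v => trop (A u v)) ^ m) u v)

theorem minPlusPow_zero (A : V → V → ℕ∞) (u v : V) :
    minPlusPow A 0 u v = if u = v then 0 else ⊤ := by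
  rw [minPlusPow, pow_zero, Matrix.one_apply, apply_ite untrop, untrop_one, untrop_zero]

theorem minPlusPow_one (A : V → V → ℕ∞) : minPlusPow A 1 = A := by
  ext u v
  rw [minPlusPow, pow_one, Matrix.of_apply, untrop_trop]

theorem minPlusPow_mul (A : V → V → ℕ∞) (a b : ℕ) :
    minPlusPow A (a * b) = minPlusPow (minPlusPow A a) b := by
  unfold minPlusPow
  simp only [pow_mul, trop_untrop]
  rfl

theorem minPlusPow_succ (A : V → V → ℕ∞) (m : ℕ) (u v : V) :
    minPlusPow A (m + 1) u v = ⨅ x, A u x + minPlusPow A m x v := by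
  rw [minPlusPow, pow_succ', Matrix.mul_apply]
  exact untrop_sum _

theorem minPlusPow_succ_le (A : V → V → ℕ∞) (m : ℕ) (u x v : V) :
    minPlusPow A (m + 1) u v ≤ A u x + minPlusPow A m x v :=
  (minPlusPow_succ A m u v).trans_le (iInf_le _ x)

theorem exists_minPlusPow_succ_eq (A : V → V → ℕ∞) (m : ℕ) (u v : V) :
    ∃ x, minPlusPow A (m + 1) u v = A u x + minPlusPow A m x v := by
  have : Nonempty V := ⟨u⟩
  obtain ⟨x, hx⟩ := exists_eq_ciInf_of_finite (f := fun x => A u x + minPlusPow A m x v)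
  exact ⟨x, (minPlusPow_succ A m u v).trans hx.symm⟩

theorem minPlusPow_succ_ne_top_iff {m : ℕ} {u v : V} :
    minPlusPow A (m + 1) u v ≠ ⊤ ↔ ∃ x, A u x ≠ ⊤ ∧ minPlusPow A m x v ≠ ⊤ := by
  simp [minPlusPow_succ]

theorem minPlusPow_mono (h : A ≤ A') (m : ℕ) : minPlusPow A m ≤ minPlusPow A' m := by
  induction m with
  | zero => intro u v; rw [minPlusPow_zero, minPlusPow_zero]
  | succ m ih =>
    intro u v
    rw [minPlusPow_succ, minPlusPow_succ]
    exact iInf_mono fun x => add_le_add (h u x) (ih x v)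

protected theorem FiniteValuesLE.minPlusPow (hA : ∀ u, FiniteValuesLE N (A u)) (m : ℕ) (u : V) :
    FiniteValuesLE (m * N) (minPlusPow A m u) := by
  induction m generalizing u with
  | zero =>
    intro v hv
    rw [minPlusPow_zero] at hv ⊢
    split_ifs at hv ⊢ <;> simp_all
  | succ m ih =>
    intro v hv
    obtain ⟨x, hx, hxv⟩ := minPlusPow_succ_ne_top_iff.1 hv
    calc minPlusPow A (m + 1) u v ≤ A u x + minPlusPow A m x v :=
          minPlusPow_succ_le A m u x v
      _ ≤ N + (m * N : ℕ) := add_le_add (hA u x hx) (ih x v hxv)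
      _ = ((m + 1) * N : ℕ) := by push_cast; ring

namespace ZeroIffEq

protected theorem minPlusPow (hA : ZeroIffEq A) (m : ℕ) : ZeroIffEq (minPlusPow A m) := by
  induction m with
  | zero => intro u v; simp [minPlusPow_zero]
  | succ m ih =>
    refine fun u v => ⟨fun h => ?_, ?_⟩
    · obtain ⟨x, hx⟩ := exists_minPlusPow_succ_eq A m u v
      rw [hx, add_eq_zero, hA, ih] at h
      exact h.1.trans h.2
    · rintro rfl
      refine nonpos_iff_eq_zero.1 ((minPlusPow_succ_le A m u u u).trans_eq ?_)
      rw [(hA u u).2 rfl, (ih u u).2 rfl, add_zero]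

theorem minPlusPow_succ_le_self (hA : ZeroIffEq A) (m : ℕ) (u v : V) :
    minPlusPow A (m + 1) u v ≤ A u v :=
  (minPlusPow_succ_le A m u v v).trans_eq (by rw [(hA.minPlusPow m v v).2 rfl, add_zero])

theorem antitone_minPlusPow (hA : ZeroIffEq A) (u v : V) :
    Antitone fun m => minPlusPow A m u v :=
  antitone_nat_of_succ_le fun m =>
    (minPlusPow_succ_le A m u u v).trans_eq (by rw [(hA u u).2 rfl, zero_add])

theorem minPlusPow_card_ne_top (hA : ZeroIffEq A) {q : ℕ} {u v : V}
    (h : minPlusPow A q u v ≠ ⊤) : minPlusPow A (Fintype.card V) u v ≠ ⊤ := by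
  let reach (j : ℕ) : Finset V := {x | minPlusPow A j x v ≠ ⊤}
  have hmono : Monotone reach := fun i j hij x hx => by
    simp only [reach, mem_filter_univ] at hx ⊢
    exact ne_top_of_le_ne_top hx (hA.antitone_minPlusPow x v hij)
  have hstep : ∀ i j, reach i = reach j → reach (i + 1) = reach (j + 1) := fun i j hij => by
    have hij' : ∀ x, minPlusPow A i x v ≠ ⊤ ↔ minPlusPow A j x v ≠ ⊤ := fun x => by
      simpa [reach] using congrArg (x ∈ ·) hij
    simp only [reach, minPlusPow_succ_ne_top_iff, hij']
  have hstable : ∀ j, #(reach j) = #(reach (j + 1)) → #(reach (j + 1)) = #(reach (j + 2)) :=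
    fun j hj => congrArg card (hstep j (j + 1) (eq_of_subset_of_card_le (hmono j.le_succ) hj.ge))
  rcases le_total q (Fintype.card V) with hq | hq
  · exact ne_top_of_le_ne_top h (hA.antitone_minPlusPow u v hq)
  · have hcard := Nat.stabilises_of_monotone (fun i j hij => card_le_card (hmono hij))
      (fun j => card_le_univ (reach j)) hstable hq
    have hu : u ∈ reach q := by simpa [reach] using h
    rw [← eq_of_subset_of_card_le (hmono hq) hcard.le] at hu
    simpa [reach] using hu

theorem finiteValuesLE_minPlusPow (hA : ZeroIffEq A) (hN : ∀ u, FiniteValuesLE N (A u)) (q : ℕ)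
    (u : V) : FiniteValuesLE (Fintype.card V * N) (minPlusPow A q u) := by
  rcases le_total q (Fintype.card V) with hq | hq
  · exact (FiniteValuesLE.minPlusPow hN q u).mono (Nat.mul_le_mul_right N hq)
  · exact fun v hv => (hA.antitone_minPlusPow u v hq).trans
      (FiniteValuesLE.minPlusPow hN _ u v (hA.minPlusPow_card_ne_top hv))

theorem exists_rows_minPlusPow (hA : ZeroIffEq A) (m : ℕ) (u v : V) :
    ∃ s : Finset V, #s ≤ m ∧ (0 < m → u ∈ s) ∧
      ∀ t, s ⊆ t → minPlusPow (restrictRows A t) m u v = minPlusPow A m u v := by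
  induction m generalizing u with
  | zero => exact ⟨∅, by simp, by simp, fun _ _ => by simp only [minPlusPow_zero]⟩
  | succ m ih =>
    obtain ⟨x, hx⟩ := exists_minPlusPow_succ_eq A m u v
    obtain ⟨s, hs, -, hst⟩ := ih x
    refine ⟨insert u s, (card_insert_le u s).trans (Nat.succ_le_succ hs),
      fun _ => mem_insert_self u s, fun t ht => ?_⟩
    refine le_antisymm ?_ (minPlusPow_mono (hA.le_restrictRows t) _ u v)
    calc minPlusPow (restrictRows A t) (m + 1) u v
        ≤ restrictRows A t u x + minPlusPow (restrictRows A t) m x v :=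
          minPlusPow_succ_le _ m u x v
      _ = A u x + minPlusPow A m x v := by
          rw [hst t ((subset_insert u s).trans ht), restrictRows_of_mem (ht (mem_insert_self u s))]
      _ = minPlusPow A (m + 1) u v := hx.symm

end ZeroIffEq

end MinPlus

section NearestRows

variable {n k : ℕ} {f g : Fin n → ℕ∞} {A : Fin n → Fin n → ℕ∞} {u v : Fin n}

theorem nodeKey_lt_of_lt (h : f u < g v) : nodeKey f u < nodeKey g v :=
  Prod.Lex.toLex_lt_toLex.2 (.inl h)

theorem le_of_nodeKey_lt (h : nodeKey f u < nodeKey f v) : f u ≤ f v :=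
  Prod.Lex.monotone_fst _ _ h.le

theorem nodeKey_const_add_lt {a : ℕ∞} (ha : a ≠ ⊤) (h : nodeKey f u < nodeKey f v) :
    nodeKey (fun x => a + f x) u < nodeKey (fun x => a + f x) v := by
  rcases Prod.Lex.toLex_lt_toLex.1 h with h | ⟨h, huv⟩
  · exact nodeKey_lt_of_lt ((ENat.add_lt_add_iff_left ha).2 h)
  · exact Prod.Lex.toLex_lt_toLex.2 (.inr ⟨congrArg (a + ·) h, huv⟩)

/- A node that precedes the first node `x` of a shortest walk from `u` to `v`, or that precedes `v`
in the order from `x`, also precedes `v` in the order from `u`. -/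
theorem ZeroIffEq.exists_nearest_midpoint (hA : ZeroIffEq A) {m : ℕ}
    (hv : v ∈ kSmallest k (minPlusPow A (m + 1) u)) (hfin : minPlusPow A (m + 1) u v ≠ ⊤) :
    ∃ x ∈ kSmallest k (A u), v ∈ kSmallest k (minPlusPow A m x) ∧
      minPlusPow A (m + 1) u v = A u x + minPlusPow A m x v := by
  obtain ⟨x, hx⟩ := exists_minPlusPow_succ_eq A m u v
  have hux : A u x ≠ ⊤ := fun h => hfin (by rw [hx, h, top_add])
  refine ⟨x, mem_kSmallest_of_forall_nodeKey_lt hv fun y hy => ?_,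
    mem_kSmallest_of_forall_nodeKey_lt hv fun y hy => ?_, hx⟩
  · by_cases hxv : x = v
    · subst hxv
      rw [(hA.minPlusPow m x x).2 rfl, add_zero] at hx
      exact (nodeKey_mono (hA.minPlusPow_succ_le_self m u y)).trans_lt
        (hy.trans_eq (nodeKey_congr hx.symm))
    · refine nodeKey_lt_of_lt ?_
      calc minPlusPow A (m + 1) u y ≤ A u y := hA.minPlusPow_succ_le_self m u y
        _ ≤ A u x := le_of_nodeKey_lt hy
        _ < A u x + minPlusPow A m x v :=
          (ENat.lt_add_left hux (pos_iff_ne_zero.2 ((hA.minPlusPow m x v).not.2 hxv))).trans_eq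
            (add_comm _ _)
        _ = minPlusPow A (m + 1) u v := hx.symm
  · calc nodeKey (minPlusPow A (m + 1) u) y ≤ nodeKey (fun y => A u x + minPlusPow A m x y) y :=
          nodeKey_mono (minPlusPow_succ_le A m u x y)
      _ < nodeKey (fun y => A u x + minPlusPow A m x y) v := nodeKey_const_add_lt hux hy
      _ = nodeKey (minPlusPow A (m + 1) u) v := nodeKey_congr hx.symm

theorem ZeroIffEq.minPlusPow_keepSmallest (hA : ZeroIffEq A) {m : ℕ}
    (hv : v ∈ kSmallest k (minPlusPow A m u)) :
    minPlusPow (fun x => keepSmallest k (A x)) m u v = minPlusPow A m u v := by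
  refine le_antisymm ?_ (minPlusPow_mono (fun x => le_keepSmallest k (A x)) m u v)
  induction m generalizing u with
  | zero => simp only [minPlusPow_zero, le_refl]
  | succ m ih =>
    by_cases htop : minPlusPow A (m + 1) u v = ⊤
    · exact htop ▸ le_top
    obtain ⟨x, hx, hxv, heq⟩ := hA.exists_nearest_midpoint hv htop
    calc minPlusPow (fun x => keepSmallest k (A x)) (m + 1) u v
        ≤ keepSmallest k (A u) x + minPlusPow (fun x => keepSmallest k (A x)) m x v :=
          minPlusPow_succ_le _ m u x v
      _ ≤ A u x + minPlusPow A m x v := add_le_add (keepSmallest_of_mem hx).le (ih hxv)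
      _ = minPlusPow A (m + 1) u v := heq.symm

protected theorem ZeroIffEq.keepSmallest (hA : ZeroIffEq A) (hk : 0 < k) :
    ZeroIffEq fun u => keepSmallest k (A u) := by
  have nodeRank_self (u : Fin n) : nodeRank (A u) u = 0 := by
    refine card_eq_zero.2 (filter_eq_empty_iff.2 fun v _ hv => hv.ne ?_)
    have hvu : A u v = 0 := nonpos_iff_eq_zero.1 ((le_of_nodeKey_lt hv).trans_eq ((hA u u).2 rfl))
    rw [(hA u v).1 hvu]
  refine fun u v => ⟨fun h => ?_, ?_⟩
  · exact (hA u v).1 (nonpos_iff_eq_zero.1 ((le_keepSmallest k (A u) v).trans_eq h))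
  · rintro rfl
    have hu : u ∈ kSmallest k (A u) := mem_kSmallest.2 ((nodeRank_self u).trans_lt hk)
    exact (keepSmallest_of_mem hu).trans ((hA u u).2 rfl)

end NearestRows

theorem choose_mul_le_pow (h m : ℕ) : (h * m).choose h ≤ (3 * m) ^ h := by
  have pow_div_factorial_le : (h : ℝ) ^ h / (h.factorial : ℝ) ≤ 3 ^ h :=
    calc (h : ℝ) ^ h / (h.factorial : ℝ) ≤ Real.exp h :=
          Real.pow_div_factorial_le_exp _ (Nat.cast_nonneg h) h
      _ = Real.exp 1 ^ h := by rw [← Real.exp_nat_mul, mul_one]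
      _ ≤ 3 ^ h := pow_le_pow_left₀ (Real.exp_pos 1).le Real.exp_one_lt_three.le h
  have : ((h * m).choose h : ℝ) ≤ (3 * m : ℝ) ^ h :=
    calc ((h * m).choose h : ℝ) ≤ ((h * m : ℕ) : ℝ) ^ h / (h.factorial : ℝ) :=
          Nat.choose_le_pow_div h (h * m)
      _ = (h : ℝ) ^ h / (h.factorial : ℝ) * m ^ h := by push_cast; ring
      _ ≤ 3 ^ h * m ^ h := mul_le_mul_of_nonneg_right pow_div_factorial_le (by positivity)
      _ = (3 * m : ℝ) ^ h := (mul_pow _ _ _).symm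
  exact_mod_cast this

theorem card_mul_card_filter_mem_powersetCard {β : Type*} [Fintype β] [DecidableEq β] (h : ℕ)
    (b : β) : Fintype.card β * #{s ∈ powersetCard h (univ : Finset β) | b ∈ s} =
      h * (Fintype.card β).choose h := by
  cases h with
  | zero => simp [filter_singleton]
  | succ h =>
    obtain ⟨p, hp⟩ := Nat.exists_eq_succ_of_ne_zero (Fintype.card_pos_iff.2 ⟨b⟩).ne'
    have hcard := card_filter_powersetCard_subset {b} univ (h + 1) (subset_univ _) (by simp)
    simp only [singleton_subset_iff, card_singleton, card_univ, hp, Nat.succ_eq_add_one,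
      Nat.add_sub_cancel] at hcard ⊢
    rw [hcard, Nat.add_one_mul_choose_eq, mul_comm]

theorem exists_map_card_fiber_le {α β : Type*} [Fintype α] [Fintype β] [DecidableEq β] {q : ℕ}
    (h : Fintype.card α ≤ Fintype.card β * q) : ∃ f : α → β, ∀ b, #{a | f a = b} ≤ q := by
  obtain ⟨e⟩ : Nonempty (α ↪ β × Fin q) := Function.Embedding.nonempty_of_card_le (by simpa using h)
  refine ⟨fun a => (e a).1, fun b => ?_⟩
  have hinj : Set.InjOn (fun a => (e a).2) ({a | (e a).1 = b} : Finset α) := fun a ha a' ha' h =>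
    e.injective (Prod.ext (by simp_all) h)
  simpa using card_le_card_of_injOn (t := univ) _ (fun _ _ => mem_univ _) hinj

theorem exists_blocks {n p : ℕ} (hp : 0 < p) (hpn : p ≤ n) :
    ∃ block : Fin n → Fin p, ∀ b, p * #{v | block v = b} ≤ 2 * n := by
  obtain ⟨block, hblock⟩ :=
    exists_map_card_fiber_le (α := Fin n) (β := Fin p) (q := n / p + 1)
      (by simpa using (Nat.lt_mul_div_succ n hp).le)
  refine ⟨block, fun b => ?_⟩
  calc p * #{v | block v = b} ≤ p * (n / p + 1) := Nat.mul_le_mul_left p (hblock b)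
    _ = p * (n / p) + p := by ring
    _ ≤ n + n := add_le_add (Nat.mul_div_le n p) hpn
    _ = 2 * n := (two_mul n).symm

/-- A cover of all sets of at most `h` nodes by one set per node, which is balanced: every node is
in at most `n / m` of the sets, and no set has more than `2 * n / m` nodes. -/
structure IsBalancedCover {n : ℕ} (h m : ℕ) (U : Fin n → Finset (Fin n)) : Prop where
  exists_subset : ∀ s : Finset (Fin n), #s ≤ h → ∃ w, s ⊆ U w
  mul_card_filter_le : ∀ v, m * #{w | v ∈ U w} ≤ n
  mul_card_le : ∀ w, m * #(U w) ≤ 2 * n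

theorem isBalancedCover_univ {n : ℕ} [NeZero n] (h : ℕ) :
    IsBalancedCover h 1 fun _ : Fin n => univ where
  exists_subset s _ := ⟨0, subset_univ s⟩
  mul_card_filter_le _ := by simp
  mul_card_le _ := by simpa using Nat.le_mul_of_pos_left n two_pos

/- Cut the nodes into `h * m` blocks of about the same size; the sets of the cover are the unions of
`h` blocks. -/
theorem exists_isBalancedCover {n h m : ℕ} (hh : 0 < h) (hm : 0 < m) (hn : (3 * m) ^ h ≤ n) :
    ∃ U : Fin n → Finset (Fin n), IsBalancedCover h m U := by
  have hchoose : (h * m).choose h ≤ n := (choose_mul_le_pow h m).trans hn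
  obtain ⟨block, hblock⟩ : ∃ block : Fin n → Fin (h * m), ∀ b, h * m * #{v | block v = b} ≤ 2 * n :=
    exists_blocks (Nat.mul_pos hh hm) <|
      calc h * m ≤ 3 ^ h * m ^ h :=
            Nat.mul_le_mul (Nat.lt_pow_self (by norm_num)).le (Nat.le_self_pow hh.ne' m)
        _ = (3 * m) ^ h := (mul_pow 3 m h).symm
        _ ≤ n := hn
  obtain ⟨choice, hchoice, hinj⟩ := exists_enumeration (k := n)
    (powersetCard h (univ : Finset (Fin (h * m)))) (by simpa using hchoose)
  refine ⟨fun w => {v | ∃ s, choice w = some s ∧ block v ∈ s}, fun s hs => ?_, fun v => ?_,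
    fun w => ?_⟩
  · obtain ⟨t, hst, ht⟩ := exists_superset_card_eq (s := s.image block) (n := h)
      (card_image_le.trans hs) (by simpa using Nat.le_mul_of_pos_right h hm)
    obtain ⟨w, hw⟩ := (hchoice t).2 (mem_powersetCard.2 ⟨subset_univ t, ht⟩)
    exact ⟨w, fun v hv => mem_filter.2 ⟨mem_univ v, t, hw, hst (mem_image_of_mem block hv)⟩⟩
  · have hle : #{w | ∃ s, choice w = some s ∧ block v ∈ s} ≤
        #{s ∈ powersetCard h (univ : Finset (Fin (h * m))) | block v ∈ s} := by
      refine card_le_card_of_forall_subsingleton (fun w s => choice w = some s) (fun w hw => ?_)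
        fun s _ w hw w' hw' => hinj s w w' hw.2 hw'.2
      obtain ⟨s, hs, hvs⟩ := (mem_filter.1 hw).2
      exact ⟨s, mem_filter.2 ⟨(hchoice s).1 ⟨w, hs⟩, hvs⟩, hs⟩
    have hcount := card_mul_card_filter_mem_powersetCard h (block v)
    rw [Fintype.card_fin, mul_assoc] at hcount
    simp only [mem_filter_univ]
    exact (Nat.mul_le_mul_left m hle).trans ((Nat.eq_of_mul_eq_mul_left hh hcount).trans_le hchoose)
  · rcases hw : choice w with _ | s
    · simp
    have hs : #s = h := (mem_powersetCard.1 ((hchoice s).1 ⟨w, hw⟩)).2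
    simp only [Option.some.injEq, exists_eq_left']
    refine Nat.le_of_mul_le_mul_left ?_ hh
    calc h * (m * #{v | block v ∈ s}) = h * m * #{v | block v ∈ s} := (mul_assoc _ _ _).symm
      _ = ∑ b ∈ s, h * m * #{v ∈ {v | block v ∈ s} | block v = b} := by
          rw [card_eq_sum_card_fiberwise (f := block) (t := s) (fun v hv => by simpa using hv),
            mul_sum]
      _ ≤ ∑ b ∈ s, 2 * n := sum_le_sum fun b _ =>
          (Nat.mul_le_mul_left _ (card_le_card (filter_subset_filter _ (subset_univ _)))).trans
            (hblock b)
      _ = h * (2 * n) := by rw [sum_const, hs, smul_eq_mul]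

theorem exists_isBalancedCover_of_le_rpow {n h k : ℕ} {C : ℝ} (hk0 : 0 < k) (hh : 0 < h)
    (hk : (k : ℝ) ≤ C * (n : ℝ) ^ (1 / (h : ℝ))) :
    ∃ m, k ≤ 6 * ⌈C⌉₊ * m ∧ ∃ U : Fin n → Finset (Fin n), IsBalancedCover h m U := by
  have hh' : (1 : ℝ) / h ≠ 0 := by positivity
  obtain rfl | hn := Nat.eq_zero_or_pos n
  · rw [Nat.cast_zero, Real.zero_rpow hh', mul_zero] at hk
    exact absurd (Nat.cast_pos.2 hk0) hk.not_gt
  have : NeZero n := ⟨hn.ne'⟩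
  set x : ℝ := (n : ℝ) ^ (1 / (h : ℝ)) with hx
  have hx0 : 0 ≤ x := Real.rpow_nonneg (Nat.cast_nonneg n) _
  have hxn : x ^ h = n := by
    rw [hx, one_div, Real.rpow_inv_natCast_pow (Nat.cast_nonneg n) hh.ne']
  have le_of_le {m : ℕ} (hm : x ≤ 6 * m) : k ≤ 6 * ⌈C⌉₊ * m := by
    have : (k : ℝ) ≤ (6 * ⌈C⌉₊ * m : ℕ) :=
      calc (k : ℝ) ≤ C * x := hk
        _ ≤ ⌈C⌉₊ * x := mul_le_mul_of_nonneg_right (Nat.le_ceil C) hx0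
        _ ≤ ⌈C⌉₊ * (6 * m) := mul_le_mul_of_nonneg_left hm (Nat.cast_nonneg _)
        _ = (6 * ⌈C⌉₊ * m : ℕ) := by push_cast; ring
    exact_mod_cast this
  rcases lt_or_ge x 3 with hx3 | hx3
  · exact ⟨1, le_of_le (by push_cast; linarith), _, isBalancedCover_univ h⟩
  have hm : 0 < ⌊x / 3⌋₊ := Nat.floor_pos.2 (by linarith)
  have hm1 : (1 : ℝ) ≤ ⌊x / 3⌋₊ := by exact_mod_cast hm
  have hmx : (3 * ⌊x / 3⌋₊ : ℝ) ≤ x := by linarith [Nat.floor_le (div_nonneg hx0 zero_le_three)]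
  have hxm : x ≤ 6 * ⌊x / 3⌋₊ := by linarith [Nat.lt_floor_add_one (x / 3)]
  have hpow : (3 * ⌊x / 3⌋₊) ^ h ≤ n := by
    have : (3 * ⌊x / 3⌋₊ : ℝ) ^ h ≤ n := hxn ▸ pow_le_pow_left₀ (by positivity) hmx h
    exact_mod_cast this
  exact ⟨_, le_of_le hxm, exists_isBalancedCover hh hm hpow⟩

namespace WDigraph

variable {n N : ℕ} {G H : WDigraph n}

/-- The matrix of the one-hop distances. -/
noncomputable def hopMatrix (G : WDigraph n) (u v : Fin n) : ℕ∞ :=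
  if u = v then 0 else G.weight u v

theorem hopMatrix_of_ne (G : WDigraph n) {u v : Fin n} (h : u ≠ v) :
    G.hopMatrix u v = G.weight u v :=
  if_neg h

theorem zeroIffEq_hopMatrix (G : WDigraph n) : ZeroIffEq G.hopMatrix := by
  intro u v
  by_cases h : u = v
  · simp [hopMatrix, h]
  · simp [G.hopMatrix_of_ne h, h, (G.pos u v).ne']

theorem hopMatrix_self (G : WDigraph n) (u : Fin n) : G.hopMatrix u u = 0 :=
  (G.zeroIffEq_hopMatrix u u).2 rfl

theorem hopMatrix_le (G : WDigraph n) (u v : Fin n) : G.hopMatrix u v ≤ G.weight u v := by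
  by_cases h : u = v
  · exact h ▸ (G.hopMatrix_self u).trans_le zero_le
  · exact (G.hopMatrix_of_ne h).le

theorem WeightsLE.finiteValuesLE_hopMatrix (hG : G.WeightsLE N) (u : Fin n) :
    FiniteValuesLE N (G.hopMatrix u) := by
  intro v hv
  by_cases h : u = v
  · exact h ▸ (G.hopMatrix_self u).trans_le zero_le
  · rw [G.hopMatrix_of_ne h] at hv ⊢
    exact hG u v hv

theorem HasPath.minPlusPow_hopMatrix_le {u v : Fin n} {t l q : ℕ} (h : G.HasPath u v t l)
    (hq : t ≤ q) : minPlusPow G.hopMatrix q u v ≤ l := by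
  induction h generalizing q with
  | nil u => exact ((G.zeroIffEq_hopMatrix.minPlusPow q u u).2 rfl).trans_le zero_le
  | @cons u x v w t l hw _ ih =>
    obtain ⟨q, rfl⟩ := Nat.exists_eq_add_one_of_ne_zero (t.succ_pos.trans_le hq).ne'
    calc minPlusPow G.hopMatrix (q + 1) u v ≤ G.hopMatrix u x + minPlusPow G.hopMatrix q x v :=
          minPlusPow_succ_le _ q u x v
      _ ≤ w + l :=
          add_le_add ((G.hopMatrix_le u x).trans_eq hw) (ih (Nat.le_of_succ_le_succ hq))
      _ = (w + l : ℕ) := (Nat.cast_add w l).symm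

theorem exists_hasPath_of_minPlusPow {u v : Fin n} {q l : ℕ}
    (h : minPlusPow G.hopMatrix q u v = l) : ∃ t ≤ q, G.HasPath u v t l := by
  induction q generalizing u l with
  | zero =>
    rw [minPlusPow_zero] at h
    split_ifs at h with huv
    · obtain rfl : l = 0 := by exact_mod_cast h.symm
      exact ⟨0, le_rfl, huv ▸ .nil u⟩
    · exact absurd h.symm (ENat.natCast_ne_top l)
  | succ q ih =>
    obtain ⟨x, hx⟩ := exists_minPlusPow_succ_eq G.hopMatrix q u v
    have htop := ENat.natCast_ne_top l
    rw [← h, hx, Ne, ENat.add_eq_top, not_or] at htop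
    obtain ⟨a, ha⟩ := ENat.ne_top_iff_exists.1 htop.1
    obtain ⟨b, hb⟩ := ENat.ne_top_iff_exists.1 htop.2
    obtain rfl : l = a + b := by
      rw [h, ← ha, ← hb] at hx
      exact_mod_cast hx
    obtain ⟨t, ht, hp⟩ := ih hb.symm
    by_cases hux : u = x
    · subst hux
      obtain rfl : a = 0 := by
        rw [hopMatrix_self] at ha
        exact_mod_cast ha
      exact ⟨t, ht.trans (Nat.le_succ q), (zero_add b).symm ▸ hp⟩
    · exact ⟨t + 1, Nat.succ_le_succ ht, .cons ((G.hopMatrix_of_ne hux).symm.trans ha.symm) hp⟩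

theorem hopDist_eq_minPlusPow (G : WDigraph n) (q : ℕ) :
    G.hopDist q = minPlusPow G.hopMatrix q := by
  funext u v
  refine le_antisymm ?_ (le_sInf ?_)
  · by_cases h : minPlusPow G.hopMatrix q u v = ⊤
    · exact h ▸ le_top
    · obtain ⟨l, hl⟩ := ENat.ne_top_iff_exists.1 h
      obtain ⟨t, ht, hp⟩ := exists_hasPath_of_minPlusPow hl.symm
      exact sInf_le ⟨t, l, ht, hp, hl.symm⟩
  · rintro _ ⟨t, l, ht, hp, rfl⟩
    exact hp.minPlusPow_hopMatrix_le ht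

theorem dist_le_hopDist (G : WDigraph n) (q : ℕ) (u v : Fin n) : G.dist u v ≤ G.hopDist q u v :=
  sInf_le_sInf fun _ ⟨t, l, _, h⟩ => ⟨t, l, h⟩

theorem WeightsLE.union (hG : G.WeightsLE N) (hH : H.WeightsLE N) : (G.union H).WeightsLE N := by
  intro u v h
  rcases min_choice (G.weight u v) (H.weight u v) with he | he <;>
    simp only [WDigraph.union, he] at h ⊢
  · exact hG u v h
  · exact hH u v h

theorem IsKNearestHopset.hopDist_union_eq {k β : ℕ} (h : IsKNearestHopset k β G H) {u v : Fin n}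
    (hv : v ∈ G.kNearest k u) : (G.union H).hopDist β u v = G.dist u v := by
  refine le_antisymm ?_ ((h.dist_eq u v).trans_le ((G.union H).dist_le_hopDist β u v))
  by_cases htop : G.dist u v = ⊤
  · exact htop ▸ le_top
  · obtain ⟨d, hd⟩ := ENat.ne_top_iff_exists.1 htop
    obtain ⟨t, ht, hp⟩ := h.path u v hv d hd.symm
    exact sInf_le ⟨t, d, ht, hp, hd.symm⟩

theorem IsKNearestHopset.nearestHopDistances_union_eq {k β : ℕ} (h : IsKNearestHopset k β G H)
    (v : Fin n) : (G.union H).nearestHopDistances k β v = G.nearestDistances k v := by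
  have hle : G.dist v ≤ (G.union H).hopDist β v := fun u =>
    (h.dist_eq v u).trans_le ((G.union H).dist_le_hopDist β v u)
  unfold nearestHopDistances nearestDistances kNearestHop kNearest
  rw [kSmallest_congr hle fun u hu => h.hopDist_union_eq hu]
  exact image_congr fun u hu => by rw [h.hopDist_union_eq hu]

end WDigraph

theorem card_word_le (c n : ℕ) :
    Fintype.card (Option (Fin n × Fin (n * (n * n ^ c) + 1))) ≤ 2 ^ messageBits (c + 4) n := by
  let X := 2 ^ (Nat.log 2 n + 1)
  have hn : n + 1 ≤ X := Nat.lt_pow_succ_log_self (by norm_num) n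
  have h2 : 2 ≤ X := Nat.le_self_pow (by omega) 2
  calc Fintype.card (Option (Fin n × Fin (n * (n * n ^ c) + 1))) = n ^ (c + 3) + (n + 1) := by
        simp only [Fintype.card_option, Fintype.card_prod, Fintype.card_fin]
        ring
    _ ≤ X ^ (c + 3) + X ^ (c + 3) :=
        add_le_add (Nat.pow_le_pow_left (by omega) _) (hn.trans (Nat.le_self_pow (by omega) X))
    _ = X ^ (c + 3) * 2 := (mul_two _).symm
    _ ≤ X ^ (c + 3) * X := Nat.mul_le_mul_left _ h2
    _ = 2 ^ messageBits (c + 4) n := by rw [← pow_succ, ← pow_mul, mul_comm, messageBits]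

namespace CliqueComputable

variable {n k B M P : ℕ} {ι : Type*} {S : Type}

theorem exchange_rows {r : Fin n → Fin n → Prop} [DecidableRel r]
    (hsend : ∀ v, #{w | r v w} * k ≤ M * n) (hreceive : ∀ w, #{v | r v w} * k ≤ M * n)
    (hB : Fintype.card (Option (Fin n × Fin (P + 1))) ≤ 2 ^ B) (σ : ι → Fin n → S)
    (row : Fin n → S → Fin n → Fin n → ℕ∞)
    (hrow : ∀ i v w, r v w → IsSparse k P (row v (σ i v) w)) :
    CliqueComputable B (4 * M) σ fun i w v => if r v w then row v (σ i v) w else ⊤ := by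
  obtain ⟨enc, dec, hdec⟩ := exists_row_code k hB
  let E := {p : Fin n × Fin n // r p.1 p.2} × Fin k
  have hsrc : ∀ v, #{e : E | e.1.1.1 = v} ≤ M * n := fun v => by
    refine le_trans ?_ (hsend v)
    calc _ ≤ #(({w | r v w} : Finset (Fin n)) ×ˢ (univ : Finset (Fin k))) :=
          card_le_card_of_injOn (fun e => (e.1.1.2, e.2)) ?_ ?_
      _ = #{w | r v w} * k := by rw [card_product, card_fin]
    · rintro ⟨⟨⟨v', w⟩, hvw⟩, j⟩ he
      obtain rfl : v' = v := by simpa using he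
      simpa using hvw
    · rintro ⟨⟨⟨v', w⟩, hvw⟩, j⟩ he ⟨⟨⟨v'', w'⟩, hvw'⟩, j'⟩ he' h
      simp_all
  have hdst : ∀ w, #{e : E | e.1.1.2 = w} ≤ M * n := fun w => by
    refine le_trans ?_ (hreceive w)
    calc _ ≤ #(({v | r v w} : Finset (Fin n)) ×ˢ (univ : Finset (Fin k))) :=
          card_le_card_of_injOn (fun e => (e.1.1.1, e.2)) ?_ ?_
      _ = #{v | r v w} * k := by rw [card_product, card_fin]
    · rintro ⟨⟨⟨v, w'⟩, hvw⟩, j⟩ he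
      obtain rfl : w' = w := by simpa using he
      simpa using hvw
    · rintro ⟨⟨⟨v, w'⟩, hvw⟩, j⟩ he ⟨⟨⟨v', w''⟩, hvw'⟩, j'⟩ he' h
      simp_all
  refine (route hsrc hdst σ fun e s => enc (row e.1.1.1 s e.1.1.2) e.2).map
    (fun w box v => if h : r v w then
      dec fun j => (box (⟨(v, w), h⟩, j)).getD fun _ => false else ⊤) fun i w => ?_
  ext1 v
  split_ifs with h
  · simpa [inbox] using hdec _ (hrow i v w h)
  · rfl

end CliqueComputable

section Step

variable {n k h m N P B : ℕ} {U : Fin n → Finset (Fin n)}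

theorem keepSmallest_iInf_cover {W : Fin n → Fin n → ℕ∞} (hk : 0 < k) (hh : 0 < h)
    (hW : ZeroIffEq W) (hU : IsBalancedCover h m U) (v : Fin n) :
    keepSmallest k (⨅ w, if v ∈ U w then
        keepSmallest k (minPlusPow (restrictRows (fun u => keepSmallest k (W u)) (U w)) h v)
      else ⊤) = keepSmallest k (minPlusPow W h v) := by
  have hR : ZeroIffEq fun u => keepSmallest k (W u) := hW.keepSmallest hk
  set R : Fin n → Fin n → ℕ∞ := fun u => keepSmallest k (W u)
  have hle (w : Fin n) : minPlusPow W h v ≤ minPlusPow (restrictRows R (U w)) h v :=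
    minPlusPow_mono (fun u => (le_keepSmallest k (W u)).trans (hR.le_restrictRows (U w) u)) h v
  have hle_iInf : minPlusPow W h v ≤ ⨅ w, if v ∈ U w then
      keepSmallest k (minPlusPow (restrictRows R (U w)) h v) else ⊤ := le_iInf fun w => by
    split_ifs
    · exact (hle w).trans (le_keepSmallest k _)
    · exact le_top
  refine keepSmallest_congr hle_iInf fun x hx => le_antisymm ?_ (hle_iInf x)
  obtain ⟨s, hs, hvs, hRs⟩ := hR.exists_rows_minPlusPow h v x
  obtain ⟨w, hw⟩ := hU.exists_subset s hs
  have heq : minPlusPow (restrictRows R (U w)) h v x = minPlusPow W h v x :=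
    (hRs (U w) hw).trans (hW.minPlusPow_keepSmallest hx)
  refine (iInf_le (fun w => if v ∈ U w then
    keepSmallest k (minPlusPow (restrictRows R (U w)) h v) else ⊤) w x).trans_eq ?_
  rw [if_pos (hw (hvs hh)), keepSmallest_of_mem (mem_kSmallest_of_le (hle w) hx heq), heq]

/- Node `w` collects the rows of the nodes in `U w` and sends each of these nodes its row of the
power of the resulting submatrix; only the `k` smallest entries of the rows are ever sent. -/
theorem CliqueComputable.keepSmallest_minPlusPow {ι : Type*} {W : ι → Fin n → Fin n → ℕ∞} {K : ℕ}
    (hk : 0 < k) (hh : 0 < h) (hU : IsBalancedCover h m U) (hkm : k ≤ K * m)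
    (hB : Fintype.card (Option (Fin n × Fin (n * N + 1))) ≤ 2 ^ B) (hW : ∀ i, ZeroIffEq (W i))
    (hN : ∀ i u, FiniteValuesLE N (W i u)) :
    CliqueComputable B (16 * K) (fun i v => keepSmallest k (W i v))
      fun i v => keepSmallest k (minPlusPow (W i) h v) := by
  let R (i : ι) (u : Fin n) : Fin n → ℕ∞ := keepSmallest k (W i u)
  have hR (i : ι) : ZeroIffEq (R i) := (hW i).keepSmallest hk
  have hRN (i : ι) (u : Fin n) : FiniteValuesLE N (R i u) := (hN i u).keepSmallest k
  have load {a : ℕ} (ha : m * a ≤ 2 * n) : a * k ≤ 2 * K * n :=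
    calc a * k ≤ a * (K * m) := Nat.mul_le_mul_left a hkm
      _ = K * (m * a) := by ring
      _ ≤ K * (2 * n) := Nat.mul_le_mul_left K ha
      _ = 2 * K * n := by ring
  have load_filter (v : Fin n) : #{w | v ∈ U w} * k ≤ 2 * K * n :=
    load ((hU.mul_card_filter_le v).trans (Nat.le_mul_of_pos_left n two_pos))
  have load_cover (w : Fin n) : #{v | v ∈ U w} * k ≤ 2 * K * n := by
    simpa using load (hU.mul_card_le w)
  have collect : CliqueComputable B (4 * (2 * K)) R fun i w => restrictRows (R i) (U w) := by
    refine (exchange_rows load_filter load_cover hB R (fun _ s _ => s) fun i v w _ => ?_).map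
      (fun w rows => restrictRows rows (U w)) fun i w => ?_
    · exact ((hN i v).mono (Nat.le_mul_of_pos_left N v.pos)).isSparse_keepSmallest k
    · ext u x
      by_cases hu : u ∈ U w <;> simp [restrictRows, hu]
  have answer : CliqueComputable B (4 * (2 * K)) (fun i w => restrictRows (R i) (U w))
      fun i v => keepSmallest k (minPlusPow (W i) h v) := by
    refine (exchange_rows (r := fun w v => v ∈ U w) load_cover load_filter hB _
      (fun _ A v => keepSmallest k (minPlusPow A h v)) fun i w v _ => ?_).map
      (fun _ rows => keepSmallest k (⨅ w, rows w)) fun i v => ?_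
    · have := ((hR i).restrictRows (U w)).finiteValuesLE_minPlusPow
        (FiniteValuesLE.restrictRows (hRN i) (U w)) h v
      rw [Fintype.card_fin] at this
      exact this.isSparse_keepSmallest k
    · exact keepSmallest_iInf_cover hk hh (hW i) hU v
  rw [show 16 * K = 4 * (2 * K) + 4 * (2 * K) by ring]
  exact collect.trans answer

end Step

theorem exists_algorithm_nearestHopDistances {c n k h : ℕ} {C : ℝ} (hk0 : 0 < k) (hh : 0 < h)
    (hk : (k : ℝ) ≤ C * (n : ℝ) ^ (1 / (h : ℝ))) (i : ℕ) {ι : Type*} {Input : Type}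
    (G : ι → WDigraph n) (hG : ∀ a, (G a).WeightsLE (n ^ c)) (input : ι → Fin n → Input)
    (row : Fin n → Input → Fin n → ℕ∞) (hrow : ∀ a v, row v (input a v) = (G a).hopMatrix v) :
    ∃ A : CliqueAlgorithm n (messageBits (c + 4) n) Input (Finset (Fin n × ℕ∞)), ∀ a v,
      A.outputAfter (input a) (96 * ⌈C⌉₊ * i) v = (G a).nearestHopDistances k (h ^ i) v := by
  obtain ⟨m, hkm, U, hU⟩ := exists_isBalancedCover_of_le_rpow hk0 hh hk
  have rows : CliqueComputable (messageBits (c + 4) n) (96 * ⌈C⌉₊ * i) input fun a v =>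
      keepSmallest k (minPlusPow (G a).hopMatrix (h ^ i) v) := by
    induction i with
    | zero =>
      refine .of_local (fun v s => keepSmallest k (row v s)) fun a v => ?_
      rw [pow_zero, minPlusPow_one, hrow]
    | succ i ih =>
      have step := CliqueComputable.keepSmallest_minPlusPow
        (W := fun a => minPlusPow (G a).hopMatrix (h ^ i)) hk0 hh hU hkm (card_word_le c n)
        (fun a => (G a).zeroIffEq_hopMatrix.minPlusPow _) fun a u => by
          simpa using (G a).zeroIffEq_hopMatrix.finiteValuesLE_minPlusPow
            (hG a).finiteValuesLE_hopMatrix (h ^ i) u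
      simp only [← minPlusPow_mul, ← pow_succ, ← mul_assoc, Nat.reduceMul] at step
      exact ih.trans step
  refine rows.map (fun _ r => open Classical in (kSmallest k r).image fun u => (u, r u))
    fun a v => ?_
  rw [WDigraph.nearestHopDistances, WDigraph.kNearestHop, WDigraph.hopDist_eq_minPlusPow,
    kSmallest_keepSmallest]
  exact image_congr fun u hu => congrArg (Prod.mk u) (keepSmallest_of_mem hu)

theorem lemma3p3 (c : ℕ) :
    ∃ b : ℕ, ∀ C : ℝ, ∃ D : ℕ, ∀ n k h i : ℕ, 0 < k → 0 < h → 0 < i →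
      (k : ℝ) ≤ C * (n : ℝ) ^ (1 / (h : ℝ)) →
      (∃ (A : CliqueAlgorithm n (messageBits b n) (IncidentEdges n × IncidentEdges n)
            (Finset (Fin n × ℕ∞))) (T : ℕ), T ≤ D * i ∧
          ∀ G H : WDigraph n, G.WeightsLE (n ^ c) → H.WeightsLE (n ^ c) →
            WDigraph.IsKNearestHopset k (h ^ i) G H →
            ∀ v : Fin n,
              A.outputAfter (fun u => (G.incident u, H.incident u)) T v =
                G.nearestDistances k v) ∧
      (∃ (A : CliqueAlgorithm n (messageBits b n) (IncidentEdges n)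
            (Finset (Fin n × ℕ∞))) (T : ℕ), T ≤ D * i ∧
          ∀ G : WDigraph n, G.WeightsLE (n ^ c) →
            ∀ v : Fin n,
              A.outputAfter (fun u => G.incident u) T v =
                G.nearestHopDistances k (h ^ i) v) := by
  refine ⟨c + 4, fun C => ⟨96 * ⌈C⌉₊, fun n k h i hk0 hh _ hk => ⟨?_, ?_⟩⟩⟩
  · obtain ⟨A, hA⟩ := exists_algorithm_nearestHopDistances hk0 hh hk i
      (ι := {p : WDigraph n × WDigraph n // p.1.WeightsLE (n ^ c) ∧ p.2.WeightsLE (n ^ c)})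
      (fun p => p.1.1.union p.1.2) (fun p => p.2.1.union p.2.2)
      (fun p v => (p.1.1.incident v, p.1.2.incident v))
      (fun v s u => if v = u then 0 else min (s.1.outgoing u) (s.2.outgoing u)) fun _ _ => rfl
    refine ⟨A, 96 * ⌈C⌉₊ * i, le_rfl, fun G H hG hH hGH v => ?_⟩
    rw [← hGH.nearestHopDistances_union_eq]
    exact hA ⟨(G, H), hG, hH⟩ v
  · obtain ⟨A, hA⟩ := exists_algorithm_nearestHopDistances hk0 hh hk i
      (ι := {G : WDigraph n // G.WeightsLE (n ^ c)}) (fun G => G.1) (fun G => G.2)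
      (fun G v => G.1.incident v) (fun v s u => if v = u then 0 else s.outgoing u) fun _ _ => rfl
    exact ⟨A, 96 * ⌈C⌉₊ * i, le_rfl, fun G hG v => hA ⟨G, hG⟩ v⟩
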